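/- For $q\in\mathbb{C}$ with $|q|<1$ and $s\in\mathbb{C}$ let \[ \mathcal{L}_q(s)=\sum_{n=1}^\infty \frac{n^s q^n}{1-q^n}, \] and for real $0<q<1$ let \[ \mathcal{S}_q(s)= i\left[\mathcal{L}_{i\sqrt q}(s)-\mathcal{L}_{-i\sqrt q}(s)\right]. \] Let $\theta=\cot^{-1}\sqrt{15}\in(0,\pi/2)$ and let $B_n$ denote the Bernoulli numbers. Then for every integer $k\ge 1$ we have $\sin(2k\theta)\neq 0$, the series $\mathcal{L}_q(-4k-1)$ converges absolutely for all $|q|<1$, at $q=e^{-\sqrt{15}\pi}$ the quantity $\mathcal{S}_q(-4k-1)$ is the sum of the absolutely convergent series \[ \mathcal{S}_{q}(-4k-1)=\sum_{n=0}^\infty (-1)^{n+1}(2n+1)^{-4k-1}\,\mathrm{sech}\!\left[(n+\tfrac12)\log q\right], \] and \[ \begin{aligned} \zeta(4k+1)=&\,(2\pi)^{4k+1}\sum_{j=0}^k \frac{(-1)^{j} c_{jk}\, B_{2j} B_{4k+2-2j}}{(2j)!\,(4k+2-2j)!}+\cot(2k\theta)\,\mathcal{S}_{e^{-\sqrt{15}\pi}}(-4k-1)\\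 &+\left(2^{-4k}+2\right)\mathcal{L}_{e^{-\sqrt{15}\pi}}(-4k-1)\\ &-\left(2^{-8k}+3\cdot 2^{-4k}+4\right)\mathcal{L}_{e^{-2\sqrt{15}\pi}}(-4k-1)\\ &+\left(2^{-8k}+2^{-4k+1}\right)\mathcal{L}_{e^{-4\sqrt{15}\pi}}(-4k-1), \end{aligned} \] where $c_{jk}=\csc(2k\theta)\,\sin[(2k+1-2j)\theta]$. -/

import Mathlib

noncomputable section

namespace LambertZeta

/-- The principal inverse cotangent, with values in `(0, π)`. -/
def arccot (x : ℝ) : ℝ := Real.pi / 2 - Real.arctan x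

theorem arccot_mem_Ioo (x : ℝ) : arccot x ∈ Set.Ioo 0 Real.pi := by
  have h1 := Real.arctan_lt_pi_div_two x
  have h2 := Real.neg_pi_div_two_lt_arctan x
  constructor <;> unfold arccot <;> linarith

theorem cot_arccot (x : ℝ) : Real.cot (arccot x) = x := by
  rw [Real.cot_eq_cos_div_sin, arccot, Real.cos_pi_div_two_sub, Real.sin_pi_div_two_sub,
    ← Real.tan_eq_sin_div_cos, Real.tan_arctan]

/-- The term of index `n + 1` of the Lambert series, i.e. `m ^ s * q ^ m / (1 - q ^ m)` with
`m = n + 1`. -/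
def lambertTerm (q s : ℂ) (n : ℕ) : ℂ :=
  ((n + 1 : ℕ) : ℂ) ^ s * q ^ (n + 1) / (1 - q ^ (n + 1))

/-- The Lambert series `∑_{m ≥ 1} m ^ s * q ^ m / (1 - q ^ m)`, used for `‖q‖ < 1`. -/
def lambert (q s : ℂ) : ℂ := ∑' n : ℕ, lambertTerm q s n

/-- `𝒮_q(s) = i [L_{i√q}(s) - L_{-i√q}(s)]`, used for real `0 < q < 1`. -/
def lambertS (q : ℝ) (s : ℂ) : ℂ :=
  Complex.I * (lambert (Complex.I * (Real.sqrt q : ℂ)) s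
    - lambert (-Complex.I * (Real.sqrt q : ℂ)) s)

/-- The term `(-1) ^ (n + 1) * (2 n + 1) ^ s * sech ((n + 1/2) * log q)` of the hyperbolic secant
series. -/
def sechTerm (q : ℝ) (s : ℂ) (n : ℕ) : ℂ :=
  (-1) ^ (n + 1) * ((2 * n + 1 : ℕ) : ℂ) ^ s
    * ((1 / Real.cosh (((n : ℝ) + 1 / 2) * Real.log q) : ℝ) : ℂ)

/-- The angle `θ = arccot √15`. -/
def theta : ℝ := arccot (Real.sqrt 15)

/-- `c_{jk} = csc (2kθ) sin ((2k + 1 - 2j) θ)`. -/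
def coeffC (j k : ℕ) : ℝ :=
  1 / Real.sin (2 * k * theta) * Real.sin ((2 * (k : ℝ) + 1 - 2 * j) * theta)

end LambertZeta

end

noncomputable section

namespace LambertZeta

open UpperHalfPlane hiding I
open Complex

/-! The result is Ramanujan's formula for odd zeta values at a special point of the unit circle.
Expanding each Lambert term through the partial fractions of the cotangent reduces the series to
`cotDouble`, and a finite geometric sum relates its values at τ and -1/τ (`cotDouble_reciprocity`);
this yields `ramanujan_formula`.

At τ = i e^{-iθ} one has -1/τ = i e^{iθ}, so the formula splits into sines and cosines of 2kθ times
the sum and difference of two Lambert series. For sin θ = 1/4 their nomes are ±i√q with q =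
e^{-√15π}: the difference is the sech series, and the sum reduces by parity to the nomes q, q², q⁴.
Division by sin(2kθ) is legitimate by a 2-adic argument. -/

/-! ### The double series and its reciprocity -/

/-- Each factor of b²(aτ/b + 1)(aτ/b - 1) is bounded below separately. This gives decay in b only;
decay in a comes from the factor a^(2K), hence K ≠ 0 below. -/
lemma sq_mul_sub_sq_norm_ge (τ : ℍ) (n m : ℕ) :
    EisensteinSeries.r τ ^ 2 * (m + 1 : ℝ) ^ 2 ≤
      ‖((n : ℂ) + 1) ^ 2 * (τ : ℂ) ^ 2 - ((m : ℂ) + 1) ^ 2‖ := by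
  have hm : (0 : ℝ) < m + 1 := by positivity
  have hm' : (m + 1 : ℂ) ≠ 0 := by exact_mod_cast hm.ne'
  have h1 := EisensteinSeries.auxbound2 τ ((n + 1 : ℝ) / (m + 1)) (d := 1) (by norm_num)
  have h2 := EisensteinSeries.auxbound2 τ ((n + 1 : ℝ) / (m + 1)) (d := -1) (by norm_num)
  have hr := (EisensteinSeries.r_pos τ).le
  have key : ((n : ℂ) + 1) ^ 2 * (τ : ℂ) ^ 2 - ((m : ℂ) + 1) ^ 2 =
      ((((n + 1 : ℝ) / (m + 1) : ℝ) : ℂ) * τ + (1 : ℝ)) *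
        ((((n + 1 : ℝ) / (m + 1) : ℝ) : ℂ) * τ + (-1 : ℝ)) * ((m + 1 : ℝ) : ℂ) ^ 2 := by
    push_cast
    field_simp
    ring
  rw [key, norm_mul, norm_mul, norm_pow, Complex.norm_of_nonneg hm.le, sq (EisensteinSeries.r τ)]
  gcongr

lemma sq_mul_sub_sq_ne_zero (τ : ℍ) (n m : ℕ) :
    ((n : ℂ) + 1) ^ 2 * (τ : ℂ) ^ 2 - ((m : ℂ) + 1) ^ 2 ≠ 0 := by
  rw [← norm_pos_iff]
  have := EisensteinSeries.r_pos τ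
  exact lt_of_lt_of_le (by positivity) (sq_mul_sub_sq_norm_ge τ n m)

/-- The summand `1 / (a ^ (2K) (a² τ² - b²))` with `a = n + 1` and `b = m + 1`. -/
def cotDoubleTerm (τ : ℂ) (K : ℕ) (p : ℕ × ℕ) : ℂ :=
  1 / (((p.1 : ℂ) + 1) ^ (2 * K) * (((p.1 : ℂ) + 1) ^ 2 * τ ^ 2 - ((p.2 : ℂ) + 1) ^ 2))

lemma summable_one_div_succ_pow {k : ℕ} (hk : 1 < k) :
    Summable fun n : ℕ ↦ 1 / ((n : ℂ) + 1) ^ k := by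
  have h := (summable_nat_add_iff 1).mpr (Complex.summable_one_div_nat_cpow (p := k).mpr (by simpa))
  simpa using h

lemma zeta_nat_eq_tsum_succ {k : ℕ} (hk : 1 < k) :
    riemannZeta k = ∑' n : ℕ, 1 / ((n : ℂ) + 1) ^ k := by
  rw [zeta_eq_tsum_one_div_nat_add_one_cpow (by simpa)]
  simp

lemma summable_cotDoubleTerm (τ : ℍ) {K : ℕ} (hK : K ≠ 0) :
    Summable (cotDoubleTerm τ K) := by
  have hr := EisensteinSeries.r_pos τ
  have h1 := (summable_one_div_succ_pow (k := 2 * K) (by lia)).norm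
  have h2 := (summable_one_div_succ_pow (k := 2) (by lia)).norm
  refine .of_norm_bounded ((h1.mul_of_nonneg h2 (fun _ ↦ norm_nonneg _)
    (fun _ ↦ norm_nonneg _)).mul_left (EisensteinSeries.r τ ^ 2)⁻¹) fun p ↦ ?_
  have hb := sq_mul_sub_sq_norm_ge τ p.1 p.2
  have e : ‖(p.2 : ℂ) + 1‖ = p.2 + 1 := by
    rw [← Nat.cast_succ, Complex.norm_natCast]; push_cast; rfl
  rw [cotDoubleTerm, norm_div, norm_mul, norm_div, norm_div, norm_pow _ 2, e, norm_one]
  rw [show (EisensteinSeries.r τ ^ 2)⁻¹ * (1 / ‖((p.1 : ℂ) + 1) ^ (2 * K)‖ *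
    (1 / ((p.2 : ℝ) + 1) ^ 2)) = 1 / (‖((p.1 : ℂ) + 1) ^ (2 * K)‖ *
    (EisensteinSeries.r τ ^ 2 * ((p.2 : ℝ) + 1) ^ 2)) by field_simp]
  have : 0 < ‖((p.1 : ℂ) + 1) ^ (2 * K)‖ := by
    rw [norm_pos_iff]; exact pow_ne_zero _ (Nat.cast_add_one_ne_zero _)
  gcongr

lemma hasSum_one_div_mul_one_div {a b : ℕ} (ha : 1 < a) (hb : 1 < b) :
    HasSum (fun p : ℕ × ℕ ↦ 1 / ((p.1 : ℂ) + 1) ^ a * (1 / ((p.2 : ℂ) + 1) ^ b))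
      (riemannZeta a * riemannZeta b) := by
  have h1 := summable_one_div_succ_pow ha
  have h2 := summable_one_div_succ_pow hb
  rw [zeta_nat_eq_tsum_succ ha, zeta_nat_eq_tsum_succ hb,
    tsum_mul_tsum_of_summable_norm h1.norm h2.norm]
  exact (summable_mul_of_summable_norm h1.norm h2.norm).hasSum

/-- Since b²σ² - a² = -(a²τ² - b²)/τ², both terms share a denominator factor, which divides the
combined numerator (aτ)^(2K) - b^(2K) with a geometric sum as quotient. -/
lemma cotDoubleTerm_swap_inv {τ σ : ℂ} (h : σ * τ = -1) (K : ℕ) (n m : ℕ)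
    (hne : ((n : ℂ) + 1) ^ 2 * τ ^ 2 - ((m : ℂ) + 1) ^ 2 ≠ 0) :
    τ ^ (2 * K) * cotDoubleTerm σ K (m, n) + τ ^ 2 * cotDoubleTerm τ K (n, m) =
      - τ ^ 2 * ∑ j ∈ Finset.range K, τ ^ (2 * j) *
        (1 / ((n : ℂ) + 1) ^ (2 * (K - j)) * (1 / ((m : ℂ) + 1) ^ (2 * (j + 1)))) := by
  have hτ : τ ≠ 0 := by rintro rfl; simp at h
  have hn : (n : ℂ) + 1 ≠ 0 := Nat.cast_add_one_ne_zero _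
  have hm : (m : ℂ) + 1 ≠ 0 := Nat.cast_add_one_ne_zero _
  obtain rfl : σ = -1 / τ := by field_simp; exact h
  simp only [cotDoubleTerm]
  generalize (n : ℂ) + 1 = a at *
  generalize (m : ℂ) + 1 = b at *
  have e : b ^ 2 * (-1 / τ) ^ 2 - a ^ 2 = -(a ^ 2 * τ ^ 2 - b ^ 2) / τ ^ 2 := by
    field_simp; ring
  have g := (Commute.all (a ^ 2 * τ ^ 2) (b ^ 2)).mul_geom_sum₂ K
  have hs : ∑ j ∈ Finset.range K, τ ^ (2 * j) * (1 / a ^ (2 * (K - j)) * (1 / b ^ (2 * (j + 1)))) =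
      (∑ i ∈ Finset.range K, (a ^ 2 * τ ^ 2) ^ i * (b ^ 2) ^ (K - 1 - i)) /
        (a ^ (2 * K) * b ^ (2 * K)) := by
    rw [Finset.sum_div]
    refine Finset.sum_congr rfl fun j hj ↦ ?_
    obtain ⟨l, rfl⟩ : ∃ l, K = j + 1 + l := ⟨K - (j + 1), by have := Finset.mem_range.mp hj; lia⟩
    rw [show j + 1 + l - j = l + 1 by lia, show j + 1 + l - 1 - j = l by lia]
    field_simp
    ring
  rw [hs, e]
  generalize ∑ i ∈ Finset.range K, (a ^ 2 * τ ^ 2) ^ i * (b ^ 2) ^ (K - 1 - i) = S at *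
  rw [mul_pow, ← pow_mul, ← pow_mul, ← pow_mul] at g
  field_simp
  linear_combination g

/-- The double series `∑ 1 / (a ^ (2K) (a² τ² - b²))` over `a, b ≥ 1`. -/
def cotDouble (τ : ℂ) (K : ℕ) : ℂ := ∑' p, cotDoubleTerm τ K p

lemma cotDouble_reciprocity {τ σ : ℍ} (h : (σ : ℂ) * τ = -1) {K : ℕ} (hK : K ≠ 0) :
    (τ : ℂ) ^ (2 * K) * cotDouble σ K + (τ : ℂ) ^ 2 * cotDouble τ K =
      - (τ : ℂ) ^ 2 * ∑ j ∈ Finset.range K, (τ : ℂ) ^ (2 * j) *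
        (riemannZeta (2 * (K - j) : ℕ) * riemannZeta (2 * (j + 1) : ℕ)) := by
  have h1 := ((Equiv.prodComm ℕ ℕ).hasSum_iff.mpr
    (summable_cotDoubleTerm σ hK).hasSum).mul_left ((τ : ℂ) ^ (2 * K))
  have h2 := (summable_cotDoubleTerm τ hK).hasSum.mul_left ((τ : ℂ) ^ 2)
  refine (h1.add h2).unique (HasSum.congr_fun (g := _) ?_ fun p ↦
    cotDoubleTerm_swap_inv h K p.1 p.2 (sq_mul_sub_sq_ne_zero τ _ _))
  refine (hasSum_sum fun j hj ↦ (hasSum_one_div_mul_one_div ?_ ?_).mul_left _).mul_left _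
  all_goals have := Finset.mem_range.mp hj; lia

/-! ### Cotangent expansion and Ramanujan's formula -/

lemma pi_mul_cot_nat_mul (τ : ℍ) (n : ℕ) :
    Real.pi * cot (Real.pi * ((n + 1) * τ)) = 1 / ((n + 1) * (τ : ℂ)) +
      ∑' m : ℕ, 2 * ((n + 1) * (τ : ℂ)) *
        (1 / (((n : ℂ) + 1) ^ 2 * (τ : ℂ) ^ 2 - ((m : ℂ) + 1) ^ 2)) := by
  have hmem : ((n : ℂ) + 1) * (τ : ℂ) ∈ integerComplement :=
    UpperHalfPlane.coe_mem_integerComplement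
      ⟨((n : ℂ) + 1) * (τ : ℂ), by
        have := τ.im_pos
        simp only [mul_im, add_re, natCast_re, one_re, coe_im, add_im, natCast_im, one_im,
          add_zero, zero_mul]
        positivity⟩
  rw [← sub_eq_iff_eq_add', cot_series_rep' hmem]
  refine tsum_congr fun m ↦ ?_
  have := cotTerm_identity hmem m
  rw [cotTerm] at this
  rw [this]
  congr 3
  ring

/-- For x = e^{2πiz}, x/(1 - x) = -1/2 + (i/2) cot πz. -/
lemma lambertTerm_exp (τ : ℍ) (K n : ℕ) :
    lambertTerm (exp (2 * Real.pi * I * τ)) (-((2 * K + 1 : ℕ) : ℂ)) n =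
      1 / ((n : ℂ) + 1) ^ (2 * K + 1) *
        (-1 / 2 + I / (2 * Real.pi) * (Real.pi * cot (Real.pi * ((n + 1) * τ)))) := by
  have hq : ‖exp (2 * Real.pi * I * τ) ^ (n + 1)‖ < 1 := by
    rw [norm_pow]
    exact pow_lt_one₀ (norm_nonneg _) (UpperHalfPlane.norm_exp_two_pi_I_lt_one τ) (by lia)
  have hq1 : 1 - exp (2 * Real.pi * I * τ) ^ (n + 1) ≠ 0 := by
    intro h0
    rw [← sub_eq_zero.mp h0] at hq
    simp at hq
  have hπ : (Real.pi : ℂ) ≠ 0 := by exact_mod_cast Real.pi_ne_zero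
  rw [cot_pi_eq_exp_ratio, show 2 * Real.pi * I * ((n + 1) * τ) =
    ((n + 1 : ℕ) : ℂ) * (2 * Real.pi * I * τ) by push_cast; ring, exp_nat_mul, lambertTerm,
    cpow_neg, cpow_natCast]
  have hn : (n : ℂ) + 1 ≠ 0 := Nat.cast_add_one_ne_zero _
  push_cast
  field_simp
  ring

lemma lambert_exp (τ : ℍ) {K : ℕ} (hK : K ≠ 0) :
    lambert (exp (2 * Real.pi * I * τ)) (-((2 * K + 1 : ℕ) : ℂ)) =
      -riemannZeta (2 * K + 1 : ℕ) / 2 + I / (2 * Real.pi) *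
        (riemannZeta (2 * (K + 1) : ℕ) / τ + 2 * τ * cotDouble τ K) := by
  have hτ : (τ : ℂ) ≠ 0 := τ.ne_zero
  have h0 := summable_cotDoubleTerm τ hK
  have h1 := h0.hasSum.prod_fiberwise fun n ↦ (h0.prod_factor n).hasSum
  have h2 := (summable_one_div_succ_pow (k := 2 * K + 1) (by lia)).hasSum
  have h3 := (summable_one_div_succ_pow (k := 2 * (K + 1)) (by lia)).hasSum
  rw [← zeta_nat_eq_tsum_succ (by lia)] at h2 h3
  have h4 := (h2.mul_left (-1 / 2)).add (((h3.div_const (τ : ℂ)).add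
    (h1.mul_left (2 * (τ : ℂ)))).mul_left (I / (2 * Real.pi)))
  rw [lambert, cotDouble, HasSum.tsum_eq (HasSum.congr_fun h4 fun n ↦ ?_)]
  · ring
  · have hn : (n : ℂ) + 1 ≠ 0 := Nat.cast_add_one_ne_zero _
    rw [lambertTerm_exp, pi_mul_cot_nat_mul, tsum_mul_left]
    have e : ∑' m, cotDoubleTerm τ K (n, m) = 1 / ((n : ℂ) + 1) ^ (2 * K) *
        ∑' m : ℕ, 1 / (((n : ℂ) + 1) ^ 2 * (τ : ℂ) ^ 2 - ((m : ℂ) + 1) ^ 2) := by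
      rw [← tsum_mul_left]
      refine tsum_congr fun m ↦ ?_
      rw [cotDoubleTerm, one_div_mul_one_div]
    rw [e]
    field_simp
    ring

/-- Ramanujan's formula for `ζ(2K + 1)`, at a point `τ` of the upper half plane and `σ = -1 / τ`. -/
theorem ramanujan_formula {τ σ : ℍ} (h : (σ : ℂ) * τ = -1) {K : ℕ} (hK : K ≠ 0) :
    Real.pi * I * τ * (lambert (exp (2 * Real.pi * I * τ)) (-((2 * K + 1 : ℕ) : ℂ))
      - (τ : ℂ) ^ (2 * K) * lambert (exp (2 * Real.pi * I * σ)) (-((2 * K + 1 : ℕ) : ℂ))) =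
    Real.pi * I * τ * (riemannZeta (2 * K + 1 : ℕ) / 2 * ((τ : ℂ) ^ (2 * K) - 1)) +
      ∑ j ∈ Finset.range (K + 2), (τ : ℂ) ^ (2 * j) *
        (riemannZeta (2 * j : ℕ) * riemannZeta (2 * (K + 1 - j) : ℕ)) := by
  have hτ : (τ : ℂ) ≠ 0 := τ.ne_zero
  have hπ : (Real.pi : ℂ) ≠ 0 := by exact_mod_cast Real.pi_ne_zero
  have hσ : (σ : ℂ) = -1 / τ := by field_simp; exact h
  have hr := cotDouble_reciprocity h hK
  -- The end terms j = 0 and j = K + 1 carry ζ(0) = -1/2 and match the contributions of the poles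
  -- 1/z of the cotangents; the middle terms come from reciprocity.
  rw [lambert_exp τ hK, lambert_exp σ hK, Finset.sum_range_succ, Finset.sum_range_succ']
  have hs : ∑ j ∈ Finset.range K, (τ : ℂ) ^ (2 * (j + 1)) *
      (riemannZeta (2 * (j + 1) : ℕ) * riemannZeta (2 * (K + 1 - (j + 1)) : ℕ)) =
      -((τ : ℂ) ^ (2 * K) * cotDouble σ K + (τ : ℂ) ^ 2 * cotDouble τ K) := by
    rw [hr, neg_mul, neg_neg, Finset.mul_sum]
    refine Finset.sum_congr rfl fun j _ ↦ ?_
    rw [Nat.add_sub_add_right]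
    ring
  rw [hs, hσ]
  simp only [mul_zero, Nat.cast_zero, riemannZeta_zero, Nat.sub_zero, Nat.sub_self]
  generalize cotDouble τ K = A
  generalize cotDouble (-1 / τ) K = B
  field_simp
  ring_nf
  simp only [I_sq]
  ring

/-! ### Parity dissection of Lambert series -/

lemma summable_lambertTerm {q s : ℂ} (hq : ‖q‖ < 1) (hs : s.re ≤ 0) :
    Summable (lambertTerm q s) := by
  have hg := (summable_geometric_of_lt_one (norm_nonneg q) hq).mul_left (1 - ‖q‖)⁻¹
  refine .of_norm_bounded hg fun n ↦ ?_
  have hpos : 0 < 1 - ‖q‖ := sub_pos.mpr hq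
  have h1 : ‖((n + 1 : ℕ) : ℂ) ^ s‖ ≤ 1 := by
    rw [norm_natCast_cpow_of_pos n.succ_pos]
    exact Real.rpow_le_one_of_one_le_of_nonpos (by exact_mod_cast n.succ_pos) hs
  have hn : ‖q‖ ^ (n + 1) ≤ ‖q‖ := pow_le_of_le_one (norm_nonneg _) hq.le (by lia)
  have hn' : ‖q‖ ^ (n + 1) ≤ ‖q‖ ^ n := pow_le_pow_of_le_one (norm_nonneg _) hq.le (by lia)
  have h2 : 1 - ‖q‖ ≤ ‖1 - q ^ (n + 1)‖ := by
    have := norm_sub_norm_le 1 (q ^ (n + 1))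
    rw [norm_one, norm_pow] at this
    linarith
  rw [lambertTerm, norm_div, norm_mul, norm_pow, ← div_eq_inv_mul]
  gcongr
  exact (mul_le_of_le_one_left (by positivity) h1).trans hn'

lemma pow_succ_ne_one {q : ℂ} (hq : ‖q‖ < 1) (n : ℕ) : q ^ (n + 1) ≠ 1 := by
  intro h
  have := pow_lt_one₀ (norm_nonneg _) hq n.succ_ne_zero
  rw [← norm_pow, h, norm_one] at this
  exact lt_irrefl _ this

/-- Indices are shifted by one: odd indices stand for even integers. -/
lemma lambertTerm_odd (q s : ℂ) (m : ℕ) :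
    lambertTerm q s (2 * m + 1) = 2 ^ s * lambertTerm (q ^ 2) s m := by
  have h : ((2 * m + 1 + 1 : ℕ) : ℂ) ^ s = 2 ^ s * ((m + 1 : ℕ) : ℂ) ^ s := by
    rw [show 2 * m + 1 + 1 = 2 * (m + 1) by ring, Nat.cast_mul, natCast_mul_natCast_cpow]
    norm_num
  rw [lambertTerm, lambertTerm, h, ← pow_mul, show 2 * m + 1 + 1 = 2 * (m + 1) by ring]
  ring

lemma lambertTerm_neg_even (q s : ℂ) (m : ℕ) :
    lambertTerm (-q) s (2 * m) =
      ((2 * m + 1 : ℕ) : ℂ) ^ s * (-q ^ (2 * m + 1)) / (1 + q ^ (2 * m + 1)) := by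
  rw [lambertTerm, Odd.neg_pow ⟨m, rfl⟩, sub_neg_eq_add]

lemma one_add_pow_odd_ne_zero {q : ℂ} (hq : ‖q‖ < 1) (m : ℕ) : 1 + q ^ (2 * m + 1) ≠ 0 := by
  have := pow_succ_ne_one (q := -q) (by rwa [norm_neg]) (2 * m)
  rw [Odd.neg_pow ⟨m, rfl⟩] at this
  contrapose this
  linear_combination -this

lemma lambertTerm_even_add_neg {q : ℂ} (hq : ‖q‖ < 1) (s : ℂ) (m : ℕ) :
    lambertTerm q s (2 * m) + lambertTerm (-q) s (2 * m) = 2 * lambertTerm (q ^ 2) s (2 * m) := by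
  have h1 : 1 - q ^ (2 * m + 1) ≠ 0 := sub_ne_zero.mpr (pow_succ_ne_one hq _).symm
  have h2 := one_add_pow_odd_ne_zero hq m
  have h3 : 1 - (q ^ 2) ^ (2 * m + 1) = (1 - q ^ (2 * m + 1)) * (1 + q ^ (2 * m + 1)) := by ring
  rw [lambertTerm_neg_even, lambertTerm, lambertTerm, h3, ← pow_mul, mul_comm 2 (2 * m + 1),
    pow_mul]
  field_simp
  ring

lemma hasSum_lambertTerm_even {q s : ℂ} (hq : ‖q‖ < 1) (hs : s.re ≤ 0) :
    HasSum (fun m ↦ lambertTerm q s (2 * m)) (lambert q s - 2 ^ s * lambert (q ^ 2) s) := by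
  have hq2 : ‖q ^ 2‖ < 1 := by rw [norm_pow]; exact pow_lt_one₀ (norm_nonneg _) hq two_ne_zero
  have h := summable_lambertTerm hq hs
  have he : Summable fun m ↦ lambertTerm q s (2 * m) :=
    h.comp_injective (mul_right_injective₀ two_ne_zero)
  have ho : HasSum (fun m ↦ lambertTerm q s (2 * m + 1)) (2 ^ s * lambert (q ^ 2) s) :=
    ((summable_lambertTerm hq2 hs).hasSum.mul_left _).congr_fun fun m ↦ lambertTerm_odd q s m
  convert he.hasSum using 1
  rw [lambert, (he.hasSum.even_add_odd ho).tsum_eq, add_sub_cancel_right]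

lemma lambert_add_lambert_neg {q s : ℂ} (hq : ‖q‖ < 1) (hs : s.re ≤ 0) :
    lambert q s + lambert (-q) s =
      2 * (1 + 2 ^ s) * lambert (q ^ 2) s - 2 * 2 ^ s * lambert (q ^ 4) s := by
  have hq2 : ‖q ^ 2‖ < 1 := by rw [norm_pow]; exact pow_lt_one₀ (norm_nonneg _) hq two_ne_zero
  have h := (hasSum_lambertTerm_even hq hs).add
    (hasSum_lambertTerm_even (q := -q) (by rwa [norm_neg]) hs)
  have h' := ((hasSum_lambertTerm_even hq2 hs).mul_left 2).congr_fun
    (fun m ↦ lambertTerm_even_add_neg hq s m)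
  have e := h.unique h'
  rw [neg_sq, ← pow_mul] at e
  linear_combination e

lemma I_mul_sqrt_sq {q : ℝ} (hq : 0 ≤ q) : (I * (√q : ℂ)) ^ 2 = -q := by
  rw [mul_pow, I_sq, ← ofReal_pow, Real.sq_sqrt hq, neg_one_mul]

lemma norm_I_mul_sqrt_lt {q : ℝ} (h1 : q < 1) : ‖I * (√q : ℂ)‖ < 1 := by
  rw [norm_mul, norm_I, one_mul, Complex.norm_of_nonneg (Real.sqrt_nonneg _)]
  rwa [Real.sqrt_lt' one_pos, one_pow]

/-- The ±q relation at i√q produces the nomes -q and q²; a second use, at q, eliminates -q. -/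
lemma lambert_I_mul_sqrt_add {q : ℝ} (h0 : 0 < q) (h1 : q < 1) {s : ℂ} (hs : s.re ≤ 0) :
    lambert (I * (√q : ℂ)) s + lambert (-I * (√q : ℂ)) s =
      -(2 * (1 + 2 ^ s)) * lambert q s
      + (4 * (1 + 2 ^ s) ^ 2 - 2 * 2 ^ s) * lambert ((q : ℂ) ^ 2) s
      - 4 * (1 + 2 ^ s) * 2 ^ s * lambert ((q : ℂ) ^ 4) s := by
  have hq : ‖(q : ℂ)‖ < 1 := by rwa [Complex.norm_of_nonneg h0.le]
  have e1 := lambert_add_lambert_neg (norm_I_mul_sqrt_lt h1) hs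
  have e2 := lambert_add_lambert_neg hq hs
  rw [show (4 : ℕ) = 2 * 2 from rfl, pow_mul, I_mul_sqrt_sq h0.le, neg_sq] at e1
  rw [neg_mul]
  linear_combination e1 + 2 * (1 + 2 ^ s) * e2

/-- Terms at even integers depend on the square of the nome and cancel. At 2m + 1, put y = √q^(2m+1)
and z = (-1)^m i y: then z/(1 - z) + z/(1 + z) = 2z/(1 + y²), and 2y/(1 + y²) = sech(log y). -/
lemma hasSum_sechTerm {q : ℝ} (h0 : 0 < q) (h1 : q < 1) {s : ℂ} (hs : s.re ≤ 0) :
    HasSum (sechTerm q s) (lambertS q s) := by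
  have hx := norm_I_mul_sqrt_lt h1
  have h := ((hasSum_lambertTerm_even hx hs).sub
    (hasSum_lambertTerm_even (q := -(I * (√q : ℂ))) (by rwa [norm_neg]) hs)).mul_left I
  rw [neg_sq, sub_sub_sub_cancel_right] at h
  rw [lambertS, neg_mul]
  refine h.congr_fun fun m ↦ ?_
  have hr : 0 < √q := Real.sqrt_pos.mpr h0
  have hlog : ((m : ℝ) + 1 / 2) * Real.log q = Real.log (√q ^ (2 * m + 1)) := by
    rw [Real.log_pow, Real.log_sqrt h0.le]
    push_cast
    ring
  have hd1 : 1 - (I * (√q : ℂ)) ^ (2 * m + 1) ≠ 0 := sub_ne_zero.mpr (pow_succ_ne_one hx _).symm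
  have hd2 := one_add_pow_odd_ne_zero hx m
  have hI : (I * (√q : ℂ)) ^ (2 * m + 1) = (-1) ^ m * I * (√q : ℂ) ^ (2 * m + 1) := by
    rw [mul_pow, pow_succ, pow_mul, I_sq]
  rw [sechTerm, hlog, Real.cosh_log (by positivity), lambertTerm_neg_even, lambertTerm]
  rw [hI] at hd1 hd2 ⊢
  push_cast
  have hy : (√q : ℂ) ^ (2 * m + 1) ≠ 0 := by
    apply pow_ne_zero; exact_mod_cast hr.ne'
  have hy2 : 1 + ((√q : ℂ) ^ (2 * m + 1)) ^ 2 ≠ 0 := by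
    exact_mod_cast (by positivity : 1 + (√q ^ (2 * m + 1)) ^ 2 ≠ 0)
  clear h hI
  generalize (√q : ℂ) ^ (2 * m + 1) = y at *
  have he : ((-1 : ℂ) ^ m) ^ 2 = 1 := by rw [← pow_mul, mul_comm, pow_mul]; simp
  have e1 : (1 - (-1) ^ m * I * y) * (1 + (-1) ^ m * I * y) = 1 + y ^ 2 := by
    linear_combination -I ^ 2 * y ^ 2 * he - y ^ 2 * I_sq
  generalize ((2 * (m : ℂ)) + 1) ^ s = c
  rw [pow_succ]
  generalize (-1 : ℂ) ^ m = ε at *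
  have e3 : 1 / ((y + y⁻¹) / 2) = 2 * y / (1 + y ^ 2) := by
    rw [show y + y⁻¹ = (1 + y ^ 2) / y by field_simp; ring]
    field_simp
  have e4 : ∀ z : ℂ, 1 - z ≠ 0 → 1 + z ≠ 0 →
      c * z / (1 - z) - c * -z / (1 + z) = 2 * c * z / ((1 - z) * (1 + z)) := by
    intro z h1 h2
    field_simp
    ring
  rw [e3, e4 _ hd1 hd2, e1]
  field_simp
  rw [I_sq, mul_neg_one]

/-! ### Bernoulli numbers and the formula on the unit circle -/

lemma riemannZeta_two_mul_nat_eq (j : ℕ) :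
    riemannZeta (2 * j : ℕ) =
      -((-1) ^ j * (2 * (Real.pi : ℂ)) ^ (2 * j) * bernoulli (2 * j) / (2 * (2 * j).factorial)) := by
  rw [Nat.cast_mul, Nat.cast_two, riemannZeta_two_mul_nat', zpow_sub₀ two_ne_zero, mul_pow]
  norm_cast
  rw [pow_succ]
  push_cast
  field_simp

/-- The coefficient `B_{2j} B_{2N-2j} / ((2j)! (2N-2j)!)`. -/
def bernoulliCoeff (N j : ℕ) : ℂ :=
  (bernoulli (2 * j) : ℂ) * (bernoulli (2 * (N - j)) : ℂ) /
    (((2 * j).factorial : ℂ) * ((2 * (N - j)).factorial : ℂ))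

lemma riemannZeta_mul_riemannZeta {N j : ℕ} (hj : j ≤ N) :
    riemannZeta (2 * j : ℕ) * riemannZeta (2 * (N - j) : ℕ) =
      (-1) ^ N * (2 * (Real.pi : ℂ)) ^ (2 * N) / 4 * bernoulliCoeff N j := by
  obtain ⟨d, rfl⟩ := Nat.exists_eq_add_of_le hj
  rw [bernoulliCoeff, Nat.add_sub_cancel_left, riemannZeta_two_mul_nat_eq,
    riemannZeta_two_mul_nat_eq]
  have h1 : ((2 * j).factorial : ℂ) ≠ 0 := by exact_mod_cast Nat.factorial_ne_zero _
  have h2 : ((2 * d).factorial : ℂ) ≠ 0 := by exact_mod_cast Nat.factorial_ne_zero _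
  field_simp
  ring

lemma sum_range_two_mul_eq_sum_add_reflect (f : ℕ → ℂ) (k : ℕ) :
    ∑ j ∈ Finset.range (2 * k + 2), f j =
      ∑ j ∈ Finset.range (k + 1), (f j + f (2 * k + 1 - j)) := by
  rw [show 2 * k + 2 = (k + 1) + (k + 1) by ring, Finset.sum_range_add, Finset.sum_add_distrib,
    ← Finset.sum_range_reflect (fun x ↦ f (k + 1 + x))]
  congr 1
  refine Finset.sum_congr rfl fun j hj ↦ ?_
  have := Finset.mem_range.mp hj
  congr 1
  lia

lemma I_mul_exp_pow_even (θ : ℝ) (n : ℕ) :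
    (I * exp (-(θ * I))) ^ (2 * n) = (-1) ^ n * exp (-(2 * n * θ * I)) := by
  rw [mul_pow, pow_mul, I_sq, ← exp_nat_mul]
  push_cast
  ring_nf

lemma exp_neg_two_mul_I (x : ℂ) : exp (-(2 * x * I)) - 1 = -(2 * I * sin x * exp (-(x * I))) := by
  rw [sin, show -(2 * x * I) = -(x * I) + -(x * I) by ring, exp_add, neg_mul]
  have : exp (x * I) * exp (-(x * I)) = 1 := by rw [← exp_add]; simp
  linear_combination this + (exp (-(x * I)) ^ 2 - exp (x * I) * exp (-(x * I))) * I_sq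

/-- The exponents are symmetric about 2k + 1, at odd distance 2k + 1 - 2j. For odd n, i^(-n) = -i^n,
so the exponentials combine to a sine. -/
lemma I_mul_exp_pow_add (θ : ℝ) {k j : ℕ} (hj : j ≤ k) :
    (I * exp (-(θ * I))) ^ (2 * j) + (I * exp (-(θ * I))) ^ (2 * (2 * k + 1 - j)) =
      (I * exp (-(θ * I))) ^ (2 * k + 1) *
        (2 * (-1) ^ (k + j) * sin ((2 * (k : ℂ) + 1 - 2 * j) * θ)) := by
  obtain ⟨d, rfl⟩ := Nat.exists_eq_add_of_le hj
  rw [show 2 * (2 * (j + d) + 1 - j) = 2 * j + 2 * (2 * d + 1) by lia,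
    show 2 * (j + d) + 1 = 2 * j + (2 * d + 1) by lia, pow_add, pow_add,
    I_mul_exp_pow_even θ (2 * d + 1)]
  have h := exp_neg_two_mul_I ((2 * d + 1) * θ)
  have h1 : (I * exp (-(θ * I))) ^ (2 * d + 1) = (-1) ^ d * I * exp (-((2 * d + 1) * θ * I)) := by
    rw [mul_pow, pow_succ, pow_mul, I_sq, ← exp_nat_mul]
    push_cast
    ring_nf
  have h2 : (-1 : ℂ) ^ (2 * d + 1) = -1 := Odd.neg_one_pow ⟨d, rfl⟩
  have h3 : (-1 : ℂ) ^ (j + d + j) = (-1) ^ d := by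
    rw [show j + d + j = 2 * j + d by ring, pow_add, pow_mul]; simp
  have h4 : (-1 : ℂ) ^ d * (-1) ^ d = 1 := by rw [← mul_pow]; simp
  rw [h1, h2, h3]
  push_cast
  rw [show (2 * ((j : ℂ) + d) + 1 - 2 * j) * θ = (2 * d + 1) * θ by ring]
  rw [show 2 * (2 * (d : ℂ) + 1) * θ * I = 2 * ((2 * d + 1) * θ) * I by ring]
  generalize (I * exp (-(θ * I))) ^ (2 * j) = A
  generalize (-1 : ℂ) ^ d = ε at *
  linear_combination (-A) * h - 2 * A * I * sin ((2 * d + 1) * θ) *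
    exp (-((2 * d + 1) * θ * I)) * h4

/-- Ramanujan's formula for `ζ(4k + 1)` at a point `τ = i e^{-iθ}` of the unit circle. -/
theorem ramanujan_formula_unit_circle {τ σ : ℍ} {θ : ℝ} (hτ : (τ : ℂ) = I * exp (-(θ * I)))
    (hσ : (σ : ℂ) = I * exp (θ * I)) {k : ℕ} (hk : k ≠ 0) {F G : ℂ}
    (hF : F = lambert (exp (2 * Real.pi * I * τ)) (-((4 * k + 1 : ℕ) : ℂ)))
    (hG : G = lambert (exp (2 * Real.pi * I * σ)) (-((4 * k + 1 : ℕ) : ℂ))) :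
    sin (2 * k * θ) * riemannZeta (4 * k + 1 : ℕ) =
      (2 * (Real.pi : ℂ)) ^ (4 * k + 1) * ∑ j ∈ Finset.range (k + 1),
        (-1) ^ j * sin ((2 * (k : ℂ) + 1 - 2 * j) * θ) * bernoulliCoeff (2 * k + 1) j
      + cos (2 * k * θ) * (I * (F - G)) - sin (2 * k * θ) * (F + G) := by
  have hee : exp (θ * I) * exp (-(θ * I)) = 1 := by rw [← exp_add]; simp
  have hστ : (σ : ℂ) * τ = -1 := by
    rw [hσ, hτ]; linear_combination I ^ 2 * hee + I_sq
  have hR := ramanujan_formula hστ (K := 2 * k) (by lia)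
  have hτ0 : (τ : ℂ) ≠ 0 := τ.ne_zero
  have hπ : (Real.pi : ℂ) ≠ 0 := by exact_mod_cast Real.pi_ne_zero
  rw [show 2 * (2 * k) + 1 = 4 * k + 1 by ring, ← hF, ← hG,
    sum_range_two_mul_eq_sum_add_reflect] at hR
  have hs : ∑ j ∈ Finset.range (k + 1), ((τ : ℂ) ^ (2 * j) *
        (riemannZeta (2 * j : ℕ) * riemannZeta (2 * (2 * k + 1 - j) : ℕ)) +
      (τ : ℂ) ^ (2 * (2 * k + 1 - j)) * (riemannZeta (2 * (2 * k + 1 - j) : ℕ) *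
        riemannZeta (2 * (2 * k + 1 - (2 * k + 1 - j)) : ℕ))) =
      -((τ : ℂ) ^ (2 * k + 1) * (-1) ^ k * (2 * (Real.pi : ℂ)) ^ (4 * k + 2) / 2) *
        ∑ j ∈ Finset.range (k + 1),
          (-1) ^ j * sin ((2 * (k : ℂ) + 1 - 2 * j) * θ) * bernoulliCoeff (2 * k + 1) j := by
    rw [Finset.mul_sum]
    refine Finset.sum_congr rfl fun j hj ↦ ?_
    have hjk : j ≤ k := Nat.lt_succ_iff.mp (Finset.mem_range.mp hj)
    have h1 := riemannZeta_mul_riemannZeta (N := 2 * k + 1) (j := j) (by lia)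
    have h2 := I_mul_exp_pow_add θ hjk
    rw [← hτ] at h2
    rw [Nat.sub_sub_self (by lia), mul_comm (riemannZeta (2 * (2 * k + 1 - j) : ℕ)), ← add_mul,
      h1, h2, Odd.neg_one_pow ⟨k, rfl⟩, show 2 * (2 * k + 1) = 4 * k + 2 by ring]
    ring
  rw [hs] at hR
  set S := ∑ j ∈ Finset.range (k + 1),
          (-1) ^ j * sin ((2 * (k : ℂ) + 1 - 2 * j) * θ) * bernoulliCoeff (2 * k + 1) j
  have hp : (τ : ℂ) ^ (2 * k) = (-1) ^ k * exp (-(2 * k * θ * I)) := by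
    rw [hτ, I_mul_exp_pow_even]
  have he : (-1 : ℂ) ^ k * (-1) ^ k = 1 := by rw [← mul_pow]; simp
  have hp2 : (τ : ℂ) ^ (2 * (2 * k)) = exp (-(2 * k * θ * I)) ^ 2 := by
    rw [mul_comm, pow_mul, hp]; linear_combination exp (-(2 * k * θ * I)) ^ 2 * he
  have hexp : exp (-(2 * k * θ * I)) = cos (2 * k * θ) - sin (2 * k * θ) * I := by
    rw [← neg_mul, exp_mul_I, cos_neg, sin_neg]; ring
  have hcs := sin_sq_add_cos_sq (2 * k * θ : ℂ)
  have hexp0 : exp (-(2 * k * θ * I)) ≠ 0 := exp_ne_zero _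
  have hE : exp (-(2 * k * θ * I)) * (cos (2 * k * θ) + sin (2 * k * θ) * I) = 1 := by
    rw [hexp]; linear_combination hcs - sin (2 * k * θ : ℂ) ^ 2 * I_sq
  rw [pow_succ (τ : ℂ) (2 * k), hp, hp2, pow_succ _ (4 * k + 1)] at hR
  generalize (2 * (Real.pi : ℂ)) ^ (4 * k + 1) = P at *
  generalize exp (-(2 * k * θ * I)) = E at *
  generalize riemannZeta (4 * k + 1 : ℕ) = Z at *
  generalize (-1 : ℂ) ^ k = ε at *
  generalize cos (2 * k * θ : ℂ) = c at *
  generalize sin (2 * k * θ : ℂ) = w at *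
  have hR' : I * (F - E ^ 2 * G) = I * (Z / 2 * (E ^ 2 - 1)) - E * P * S := by
    refine mul_left_cancel₀ (mul_ne_zero hπ hτ0) ?_
    linear_combination hR - Real.pi * τ * E * P * S * he
  -- With E = c - iw and 1/E = c + iw, (F - E²G)/E = c(F - G) + iw(F + G) and (E² - 1)/E = -2iw.
  refine mul_left_cancel₀ hexp0 ?_
  linear_combination (-1) * hR' - (I * F + I * Z / 2) * hE - (I * E * G + I * Z / 2 * E) * hexp +
    E * w * (F + G + Z) * I_sq

/-! ### The angle θ and the two special points -/

lemma sin_arccot (x : ℝ) : Real.sin (arccot x) = 1 / √(1 + x ^ 2) := by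
  rw [arccot, Real.sin_pi_div_two_sub, Real.cos_arctan]

lemma cos_arccot (x : ℝ) : Real.cos (arccot x) = x / √(1 + x ^ 2) := by
  rw [arccot, Real.cos_pi_div_two_sub, Real.sin_arctan]

lemma sqrt_one_add_sqrt_fifteen_sq : √(1 + √15 ^ 2) = 4 := by
  rw [Real.sq_sqrt (by norm_num), show (1 + 15 : ℝ) = 4 ^ 2 by norm_num, Real.sqrt_sq (by norm_num)]

lemma sin_theta : Real.sin theta = 1 / 4 := by
  rw [theta, sin_arccot, sqrt_one_add_sqrt_fifteen_sq]

lemma cos_theta : Real.cos theta = √15 / 4 := by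
  rw [theta, cos_arccot, sqrt_one_add_sqrt_fifteen_sq]

/-- `4 ^ k sin (2kθ)` is an odd multiple of `√15 / 2` for `k ≥ 1`. -/
lemma exists_odd_sin_two_mul_theta (k : ℕ) :
    ∃ a b : ℤ, Odd a ∧ 4 ^ (k + 1) * Real.sin (2 * (k + 1 : ℕ) * theta) = a * (√15 / 2) ∧
      4 ^ k * Real.sin (2 * k * theta) = b * (√15 / 2) := by
  have h15 : √15 ^ 2 = 15 := Real.sq_sqrt (by norm_num)
  have hc : Real.cos (2 * theta) = 7 / 8 := by
    rw [Real.cos_two_mul, cos_theta]; linear_combination h15 / 8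
  induction k with
  | zero =>
    refine ⟨1, 0, odd_one, ?_, by simp⟩
    rw [Nat.zero_add, Nat.cast_one, mul_one, Real.sin_two_mul, sin_theta, cos_theta]
    push_cast
    ring
  | succ k ih =>
    obtain ⟨a, b, ha, h1, h2⟩ := ih
    -- The three-term recurrence of sin(2kθ) has coefficient 2 cos 2θ = 7/4; scaling by powers of 4
    -- makes it integral, and 7a - 16b has the parity of a.
    refine ⟨7 * a - 16 * b, a, ?_, ?_, h1⟩
    · rw [show 7 * a - 16 * b = a + 2 * (3 * a - 8 * b) by ring]
      exact ha.add_even (even_two_mul _)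
    · have e1 : Real.sin (2 * (k + 1 + 1 : ℕ) * theta) =
          2 * Real.cos (2 * theta) * Real.sin (2 * (k + 1 : ℕ) * theta)
            - Real.sin (2 * k * theta) := by
        have p1 : 2 * ((k + 1 + 1 : ℕ) : ℝ) * theta = 2 * (k + 1 : ℕ) * theta + 2 * theta := by
          push_cast; ring
        have p2 : 2 * (k : ℝ) * theta = 2 * (k + 1 : ℕ) * theta - 2 * theta := by
          push_cast; ring
        rw [p1, p2, Real.sin_add, Real.sin_sub]
        ring
      rw [e1, hc]
      push_cast at *
      linear_combination 7 * h1 - 16 * h2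

lemma sin_two_mul_theta_ne_zero {k : ℕ} (hk : 1 ≤ k) : Real.sin (2 * k * theta) ≠ 0 := by
  obtain ⟨n, rfl⟩ := Nat.exists_eq_add_of_le' hk
  obtain ⟨a, b, ha, h, -⟩ := exists_odd_sin_two_mul_theta n
  intro h0
  rw [h0, mul_zero] at h
  have h15 : √15 / 2 ≠ 0 := by positivity
  have : (a : ℝ) = 0 := by simpa [h15] using h.symm
  rw [Int.cast_eq_zero.mp this] at ha
  exact Int.not_odd_zero ha

/-- The point `(1 + i√15) / 4`. -/
def tauPos : ℍ := ⟨(1 + √15 * I) / 4, by simp⟩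

/-- The point `(-1 + i√15) / 4`. -/
def tauNeg : ℍ := ⟨(-1 + √15 * I) / 4, by simp⟩

lemma tauPos_eq : (tauPos : ℂ) = I * exp (-(theta * I)) := by
  have e : (tauPos : ℂ) = (1 + √15 * I) / 4 := rfl
  rw [e, ← neg_mul, exp_mul_I, cos_neg, sin_neg, ← ofReal_cos, ← ofReal_sin, sin_theta, cos_theta]
  push_cast
  linear_combination I_sq / 4

lemma tauNeg_eq : (tauNeg : ℂ) = I * exp (theta * I) := by
  have e : (tauNeg : ℂ) = (-1 + √15 * I) / 4 := rfl
  rw [e, exp_mul_I, ← ofReal_cos, ← ofReal_sin, sin_theta, cos_theta]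
  push_cast
  linear_combination (-1) * I_sq / 4

/-- The real part 1/4 gives the factor e^{πi/2} = i, and the imaginary part √15/4 gives √q. -/
lemma exp_tauPos :
    exp (2 * Real.pi * I * tauPos) = I * (√(Real.exp (-(√15 * Real.pi))) : ℂ) := by
  have e : (tauPos : ℂ) = (1 + √15 * I) / 4 := rfl
  rw [← Real.exp_half, e, show 2 * Real.pi * I * ((1 + √15 * I) / 4) =
    Real.pi / 2 * I + ((-(√15 * Real.pi) / 2 : ℝ) : ℂ) by
      push_cast; linear_combination Real.pi * √15 / 2 * I_sq, exp_add, exp_pi_div_two_mul_I,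
    ofReal_exp]

lemma exp_tauNeg :
    exp (2 * Real.pi * I * tauNeg) = -I * (√(Real.exp (-(√15 * Real.pi))) : ℂ) := by
  have e : (tauNeg : ℂ) = (-1 + √15 * I) / 4 := rfl
  rw [← Real.exp_half, e, show 2 * Real.pi * I * ((-1 + √15 * I) / 4) =
    -Real.pi / 2 * I + ((-(√15 * Real.pi) / 2 : ℝ) : ℂ) by
      push_cast; linear_combination Real.pi * √15 / 2 * I_sq, exp_add, exp_neg_pi_div_two_mul_I,
    ofReal_exp]

end LambertZeta

end

/-! ### Assembly of the zeta formula -/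

open LambertZeta Complex in
theorem mainTheorem3 (k : ℕ) (hk : 1 ≤ k) :
    Real.sin (2 * k * LambertZeta.theta) ≠ 0 ∧
    (∀ q : ℂ, ‖q‖ < 1 → Summable (LambertZeta.lambertTerm q (-4 * (k : ℂ) - 1))) ∧
    HasSum (LambertZeta.sechTerm (Real.exp (-(Real.sqrt 15 * Real.pi))) (-4 * (k : ℂ) - 1))
      (LambertZeta.lambertS (Real.exp (-(Real.sqrt 15 * Real.pi))) (-4 * (k : ℂ) - 1)) ∧
    riemannZeta (4 * (k : ℂ) + 1) =
      (2 * (Real.pi : ℂ)) ^ (4 * k + 1) *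
          ∑ j ∈ Finset.range (k + 1),
            (-1) ^ j * (LambertZeta.coeffC j k : ℂ) * (bernoulli (2 * j) : ℂ)
                * (bernoulli (4 * k + 2 - 2 * j) : ℂ)
              / ((Nat.factorial (2 * j) : ℂ) * (Nat.factorial (4 * k + 2 - 2 * j) : ℂ))
        + (Real.cot (2 * k * LambertZeta.theta) : ℂ)
            * LambertZeta.lambertS (Real.exp (-(Real.sqrt 15 * Real.pi))) (-4 * (k : ℂ) - 1)
        + ((2 : ℂ) ^ (-4 * (k : ℤ)) + 2)
            * LambertZeta.lambert (Real.exp (-(Real.sqrt 15 * Real.pi))) (-4 * (k : ℂ) - 1)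
        - ((2 : ℂ) ^ (-8 * (k : ℤ)) + 3 * (2 : ℂ) ^ (-4 * (k : ℤ)) + 4)
            * LambertZeta.lambert (Real.exp (-(2 * Real.sqrt 15 * Real.pi))) (-4 * (k : ℂ) - 1)
        + ((2 : ℂ) ^ (-8 * (k : ℤ)) + (2 : ℂ) ^ (-4 * (k : ℤ) + 1))
            * LambertZeta.lambert (Real.exp (-(4 * Real.sqrt 15 * Real.pi)))
                (-4 * (k : ℂ) - 1) := by
  have hq0 : 0 < Real.exp (-(√15 * Real.pi)) := Real.exp_pos _
  have hq1 : Real.exp (-(√15 * Real.pi)) < 1 := by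
    rw [Real.exp_lt_one_iff]
    exact neg_neg_of_pos (by positivity)
  have hs : (-4 * (k : ℂ) - 1).re ≤ 0 := by
    simp only [sub_re, mul_re, neg_re, re_ofNat, natCast_re, neg_im, im_ofNat, natCast_im,
      one_re]
    have : (0 : ℝ) ≤ k := k.cast_nonneg
    linarith
  have hsin := sin_two_mul_theta_ne_zero hk
  refine ⟨hsin, fun q hq ↦ summable_lambertTerm hq hs, hasSum_sechTerm hq0 hq1 hs, ?_⟩
  have hse : -((4 * k + 1 : ℕ) : ℂ) = -4 * (k : ℂ) - 1 := by push_cast; ring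
  have hR := ramanujan_formula_unit_circle tauPos_eq tauNeg_eq (k := k) (by lia) rfl rfl
  have hadd := lambert_I_mul_sqrt_add hq0 hq1 hs
  -- With this value of 2^s, the coefficients 2(1 + 2^s), 4(1 + 2^s)² - 2·2^s and 4(1 + 2^s)2^s
  -- become those of the theorem.
  have h2s : (2 : ℂ) ^ (-4 * (k : ℂ) - 1) = (2 : ℂ) ^ (-4 * (k : ℤ)) / 2 := by
    rw [cpow_sub _ _ two_ne_zero, cpow_one, ← cpow_intCast]
    push_cast
    rfl
  have h8 : (2 : ℂ) ^ (-8 * (k : ℤ)) = ((2 : ℂ) ^ (-4 * (k : ℤ))) ^ 2 := by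
    rw [← zpow_natCast, ← zpow_mul]
    congr 1
    push_cast
    ring
  have e2 : (Real.exp (-(√15 * Real.pi)) : ℂ) ^ 2 = Real.exp (-(2 * √15 * Real.pi)) := by
    rw [← ofReal_pow, ← Real.exp_nat_mul]
    congr 2
    push_cast
    ring
  have e4 : (Real.exp (-(√15 * Real.pi)) : ℂ) ^ 4 = Real.exp (-(4 * √15 * Real.pi)) := by
    rw [← ofReal_pow, ← Real.exp_nat_mul]
    congr 2
    push_cast
    ring
  have hsum : ∑ j ∈ Finset.range (k + 1),
      (-1) ^ j * (coeffC j k : ℂ) * (bernoulli (2 * j) : ℂ) * (bernoulli (4 * k + 2 - 2 * j) : ℂ)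
        / ((Nat.factorial (2 * j) : ℂ) * (Nat.factorial (4 * k + 2 - 2 * j) : ℂ)) =
      (∑ j ∈ Finset.range (k + 1), (-1) ^ j * Complex.sin ((2 * (k : ℂ) + 1 - 2 * j) * theta) *
        bernoulliCoeff (2 * k + 1) j) / (Real.sin (2 * k * theta) : ℂ) := by
    rw [Finset.sum_div]
    refine Finset.sum_congr rfl fun j _ ↦ ?_
    rw [bernoulliCoeff, coeffC, show 2 * (2 * k + 1 - j) = 4 * k + 2 - 2 * j by lia]
    push_cast
    ring
  rw [hse, exp_tauPos, exp_tauNeg, hadd, e2, e4, h2s] at hR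
  have hz : ((4 * k + 1 : ℕ) : ℂ) = 4 * k + 1 := by push_cast; rfl
  rw [hz] at hR
  have hsin' : Complex.sin (2 * k * theta) = (Real.sin (2 * k * theta) : ℂ) := by push_cast; rfl
  have hcos' : Complex.cos (2 * k * theta) = (Real.cos (2 * k * theta) : ℂ) := by push_cast; rfl
  have hsinC : (Real.sin (2 * k * theta) : ℂ) ≠ 0 := by exact_mod_cast hsin
  rw [hsin', hcos'] at hR
  rw [hsum, Real.cot_eq_cos_div_sin, h8, zpow_add₀ two_ne_zero, zpow_one, lambertS, ofReal_div]
  refine mul_left_cancel₀ hsinC ?_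
  rw [hR]
  generalize ∑ j ∈ Finset.range (k + 1), (-1) ^ j *
    Complex.sin ((2 * (k : ℂ) + 1 - 2 * j) * theta) * bernoulliCoeff (2 * k + 1) j = S
  field_simp
  ring
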